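/- Let $p$ be a prime and let $n,k\ge 1$ and $h\ge 0$ be integers such that $p^h\mid n$, $k\le p^h$ and $p-1\mid n-k$. Let $S(n,k)$ be the Stirling number of the second kind, $\nu_p$ the $p$-adic valuation, and $\sigma_p(k)$ the sum of the base-$p$ digits of $k$. Let $k'$ be the least positive residue of $k$ modulo $p-1$, i.e. $1\le k'\le p-1$ and $k'\equiv k \pmod{p-1}$. For $l\in\mathbb Z$ define the higher order Bernoulli polynomials $B_m^{(l)}(x)\in\mathbb Q[x]$ by $$\left(\frac{t}{e^t-1}\right)^{l}e^{tx}=\sum_{m\ge 0}B_m^{(l)}(x)\,\frac{t^m}{m!},$$ and let $M$ be the maximum pole of $B_{n-k}^{(-k)}(x)$ at $p$, i.e. the largest exponent $e$ such that $p^e$ divides the denominator of some coefficient of this polynomial. Then: 1. $S(n,k)$ is an almost minimum zero case, i.e. the almost minimum zero estimate $\nu_p(S(n,k))\ge\nu_p\binom nk-M$ is sharp: $\nu_p(S(n,k))=\nu_p\binom nk-M$. 2. $\displaystyle \nu_p(S(n,k))=\frac{\sigma_p(k)-k'}{p-1}=\left\lfloor\frac{\sigma_p(k)-1}{p-1}\right\rfloor.$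 In particular, $\nu_p(S(n,k))$ depends only on $p$ and $k$, not on $n$ and $h$. For $p=2$ this is Lengyel's formula $\nu_2(S(c2^h,k))=\sigma_2(k)-1$ for $c\ge 1$ and $1\le k\le 2^h$. -/

import Mathlib

/-- The power series `(e^t - 1) / t = ∑ t^n / (n + 1)!` over `ℚ`. -/
noncomputable def expSubOneDivT : PowerSeries ℚ :=
  PowerSeries.mk fun n => (1 : ℚ) / ((n + 1).factorial : ℚ)

theorem X_mul_expSubOneDivT :
    (PowerSeries.X : PowerSeries ℚ) * expSubOneDivT = PowerSeries.exp ℚ - 1 := by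
  ext n
  cases n with
  | zero => simp
  | succ n => simp [expSubOneDivT, PowerSeries.coeff_succ_X_mul, PowerSeries.coeff_exp,
      PowerSeries.coeff_one]

/-- The power series `(t / (e^t - 1))^l` over `ℚ`, for an integer `l`: for negative `l` this is
the power `((e^t - 1) / t)^(-l)`. -/
noncomputable def bernoulliFactor : ℤ → PowerSeries ℚ
  | Int.ofNat m => (expSubOneDivT⁻¹) ^ m
  | Int.negSucc m => expSubOneDivT ^ (m + 1)

/-- The higher order Bernoulli polynomial `B_n^{(l)}(x)`, defined by
`(t / (e^t - 1))^l * e^(t x) = ∑ B_n^{(l)}(x) t^n / n!`. Here `e^(t x)` is the exponential series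
over `ℚ[x]` with `t` replaced by `x t`. -/
noncomputable def higherBernoulli (l : ℤ) (n : ℕ) : Polynomial ℚ :=
  (n.factorial : ℚ) •
    PowerSeries.coeff n
      (PowerSeries.map (Polynomial.C : ℚ →+* Polynomial ℚ) (bernoulliFactor l) *
        PowerSeries.rescale (Polynomial.X : Polynomial ℚ) (PowerSeries.exp (Polynomial ℚ)))

/-- The maximum pole of `f` at `p`: the exponent of the highest power of `p` that divides the
denominator of a coefficient of `f`. -/
noncomputable def maxPole (p : ℕ) (f : Polynomial ℚ) : ℕ :=
  f.support.sup fun i => padicValNat p (f.coeff i).den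

/-- `S(n,k)` is an almost minimum zero case for `p`: the almost minimum zero estimate
`ν_p(S(n,k)) ≥ ν_p(C(n,k)) - M`, with `M` the maximum pole of `B_{n-k}^{(-k)}(x)`, is sharp.
The first clause says that `ν_p(S(n,k))` is finite; it fails for `k > n`. -/
def IsAMZC (p n k : ℕ) : Prop :=
  Nat.stirlingSecond n k ≠ 0 ∧
    (padicValNat p (Nat.stirlingSecond n k) : ℤ) =
      (padicValNat p (n.choose k) : ℤ) - (maxPole p (higherBernoulli (-(k : ℤ)) (n - k)) : ℤ)

/-- The digit sum `σ_p(k)` of `k` in base `p`. -/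
def digitSum (p k : ℕ) : ℕ := (Nat.digits p k).sum

/-- The least positive residue of `k` modulo `m`. -/
def leastPosResidue (m k : ℕ) : ℕ := if k % m = 0 then m else k % m

theorem leastPosResidue_spec {m : ℕ} (hm : 0 < m) (k : ℕ) :
    1 ≤ leastPosResidue m k ∧ leastPosResidue m k ≤ m ∧ leastPosResidue m k ≡ k [MOD m] := by
  unfold leastPosResidue
  have := Nat.mod_lt k hm
  split_ifs with h
  · exact ⟨hm, le_rfl, by simp [Nat.ModEq, h]⟩
  · exact ⟨by omega, this.le, Nat.mod_modEq k m⟩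

open Finset

/-! Work with `k! * S(n,k)`, the `k`-th difference of `x ^ n` at `0`, and scale valuations by `p -
1`: Legendre's and Kummer's theorems then become statements about digit sums. The basic bound is `(p
- 1) ν_p(k! S(n,k)) ≥ k - σ_p(n)` (`ValGE.diffPow`).

For `n = (c + 1) p^s` with `c + 1 < p` and `k ≡ c + 1` mod `p - 1`, this bound is attained: Newton's
formula for a shift by `p` relates `p Δ^{k+1}` to `Δ^{k+p}` up to terms of higher weight, so
sharpness propagates from `k = c + 1` (`not_valGE_diffPow`). A general multiplier of `p^s` reduces
to this case because its residue mod `p - 1` determines the differences up to weight `k`, as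
comparison with approximate Teichmüller representatives shows (`ValGE.diffPow_add_sub_mul_pow`).

For the pole, the coefficient of `x^i` in the Bernoulli polynomial is `C(n,i) S(n-i,k) / C(n,k)`. A
uniform bound on the numerators (`ValGE.choose_mul_diffPow`) falls short of the valuation at `i = 0`
by less than `p - 1` on the scaled side, hence by less than one unit of valuation. So the constant
term carries the maximum pole. -/

/-- `(p - 1) * ν_p(x) ≥ q`, with `ν_p(0) = ∞`. -/
def ValGE (p : ℕ) (q x : ℤ) : Prop := x = 0 ∨ q ≤ ((p : ℤ) - 1) * padicValInt p x

/-! ### Calculus of scaled valuation bounds. -/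

namespace ValGE

variable {p : ℕ} [hp : Fact p.Prime] {q q₁ q₂ x y : ℤ}

theorem zero (p : ℕ) (q : ℤ) : ValGE p q 0 := Or.inl rfl

omit hp in
theorem mono (h : ValGE p q₁ x) (hq : q₂ ≤ q₁) : ValGE p q₂ x :=
  h.imp_right hq.trans

theorem of_nonpos (hq : q ≤ 0) (x : ℤ) : ValGE p q x := by
  right
  have : (1 : ℤ) ≤ p := by exact_mod_cast hp.out.one_le
  exact hq.trans (mul_nonneg (by linarith) (by positivity))

theorem of_pow_dvd {j : ℕ} (h : (p : ℤ) ^ j ∣ x) : ValGE p (((p : ℤ) - 1) * j) x := by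
  rcases (padicValInt_dvd_iff j x).1 h with h | h
  · exact Or.inl h
  · right
    have : (1 : ℤ) ≤ p := by exact_mod_cast hp.out.one_le
    exact mul_le_mul_of_nonneg_left (by exact_mod_cast h) (by linarith)

omit hp in
theorem neg (h : ValGE p q x) : ValGE p q (-x) := by
  simpa [ValGE, padicValInt] using h

theorem add (hx : ValGE p q x) (hy : ValGE p q y) : ValGE p q (x + y) := by
  rcases hx with rfl | hx
  · rwa [zero_add]
  rcases hy with rfl | hy
  · rw [add_zero]; exact Or.inr hx
  have key := dvd_add
    ((pow_dvd_pow (p : ℤ) (min_le_left (padicValInt p x) (padicValInt p y))).trans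
      (padicValInt_dvd x))
    ((pow_dvd_pow (p : ℤ) (min_le_right (padicValInt p x) (padicValInt p y))).trans
      (padicValInt_dvd y))
  refine (of_pow_dvd key).mono ?_
  rcases min_choice (padicValInt p x) (padicValInt p y) with h | h <;> rw [h] <;> assumption

theorem sub (hx : ValGE p q x) (hy : ValGE p q y) : ValGE p q (x - y) := by
  simpa [sub_eq_add_neg] using hx.add hy.neg

theorem sum {ι : Type*} {s : Finset ι} {f : ι → ℤ} (h : ∀ i ∈ s, ValGE p q (f i)) :
    ValGE p q (∑ i ∈ s, f i) :=
  Finset.sum_induction f (ValGE p q) (fun _ _ => add) (zero p q) h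

theorem mul (hx : ValGE p q₁ x) (hy : ValGE p q₂ y) : ValGE p (q₁ + q₂) (x * y) := by
  rcases hx with rfl | hx
  · simp [ValGE]
  rcases hy with rfl | hy
  · simp [ValGE]
  by_cases h0 : x = 0
  · simp [ValGE, h0]
  by_cases h1 : y = 0
  · simp [ValGE, h1]
  right
  rw [padicValInt.mul h0 h1]
  push_cast
  linarith

theorem mul_left (hy : ValGE p q y) (x : ℤ) : ValGE p q (x * y) := by
  simpa using (of_nonpos le_rfl x).mul hy

/-- Multiplication by a nonzero factor shifts the bound by exactly its valuation. -/
theorem mul_left_iff (hx : x ≠ 0) :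
    ValGE p (((p : ℤ) - 1) * padicValInt p x + q) (x * y) ↔ ValGE p q y := by
  by_cases h1 : y = 0
  · simp [ValGE, h1]
  simp only [ValGE, mul_eq_zero, hx, h1, false_or, padicValInt.mul hx h1]
  push_cast
  rw [mul_add, add_le_add_iff_left]

theorem p_mul_iff : ValGE p (((p : ℤ) - 1) + q) (p * y) ↔ ValGE p q y := by
  have := mul_left_iff (p := p) (q := q) (y := y) (x := p) (by exact_mod_cast hp.out.ne_zero)
  rwa [padicValInt_self, Nat.cast_one, mul_one] at this

/-- Legendre's formula. It passes between bounds for `diffPow n k` and for `S(n,k)`. -/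
theorem factorial_mul_iff (k : ℕ) :
    ValGE p (k - digitSum p k + q) (k.factorial * y) ↔ ValGE p q y := by
  have := mul_left_iff (p := p) (q := q) (y := y) (x := k.factorial)
    (by exact_mod_cast k.factorial_ne_zero)
  have h2 := sub_one_mul_padicValNat_factorial (p := p) k
  have h3 : (p.digits k).sum ≤ k := Nat.digit_sum_le p k
  have h4 : ((p : ℤ) - 1) * padicValInt p (k.factorial : ℤ) = k - digitSum p k := by
    rw [padicValInt.of_nat, digitSum, ← Nat.cast_sub h3, ← h2]
    push_cast [hp.out.one_le]
    rfl
  rwa [h4] at this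

theorem factorial (k : ℕ) : ValGE p (k - digitSum p k) (k.factorial : ℤ) := by
  simpa using (factorial_mul_iff (p := p) (q := 0) (y := 1) k).2 (of_nonpos le_rfl _)

end ValGE

/-! ### Base-`p` digit sums. -/

section digitSum

variable {p : ℕ} [hp : Fact p.Prime]

theorem digitSum_zero (p : ℕ) : digitSum p 0 = 0 := by simp [digitSum]

theorem digitSum_eq_mod_add_div (n : ℕ) : digitSum p n = n % p + digitSum p (n / p) := by
  rcases Nat.eq_zero_or_pos n with rfl | hn
  · simp [digitSum]
  · simp [digitSum, Nat.digits_def' hp.out.one_lt hn]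

theorem digitSum_of_lt {n : ℕ} (h : n < p) : digitSum p n = n := by
  rw [digitSum_eq_mod_add_div, Nat.div_eq_of_lt h, Nat.mod_eq_of_lt h, digitSum_zero, add_zero]

theorem digitSum_pow_mul_add (s a : ℕ) {b : ℕ} (hb : b < p ^ s) :
    digitSum p (p ^ s * a + b) = digitSum p a + digitSum p b := by
  induction s generalizing b with
  | zero => simp_all [digitSum_zero]
  | succ s ih =>
    have hpos := hp.out.pos
    have h1 : (p ^ (s + 1) * a + b) / p = p ^ s * a + b / p := by
      rw [pow_succ', mul_assoc, add_comm, Nat.add_mul_div_left _ _ hpos, add_comm]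
    have h2 : (p ^ (s + 1) * a + b) % p = b % p := by
      rw [pow_succ', mul_assoc, Nat.mul_add_mod]
    rw [digitSum_eq_mod_add_div, h1, h2, ih, digitSum_eq_mod_add_div b]
    · ring
    · exact Nat.div_lt_of_lt_mul (by rwa [← pow_succ'])

theorem digitSum_mul_pow (a s : ℕ) : digitSum p (a * p ^ s) = digitSum p a := by
  have := digitSum_pow_mul_add (p := p) s a (b := 0) (pow_pos hp.out.pos s)
  rwa [add_zero, digitSum_zero, add_zero, mul_comm] at this

theorem digitSum_pow (s : ℕ) : digitSum p (p ^ s) = 1 := by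
  rw [← one_mul (p ^ s), digitSum_mul_pow, digitSum_of_lt hp.out.one_lt]

theorem digitSum_le_of_lt_pow {s n : ℕ} (h : n < p ^ s) : digitSum p n ≤ (p - 1) * s := by
  induction s generalizing n with
  | zero => simp_all [digitSum_zero]
  | succ s ih =>
    rw [digitSum_eq_mod_add_div]
    have := ih (Nat.div_lt_of_lt_mul (by rwa [← pow_succ']) : n / p < p ^ s)
    have := Nat.mod_lt n hp.out.pos
    rw [mul_add, mul_one]
    omega

theorem digitSum_pow_sub_one (s : ℕ) : digitSum p (p ^ s - 1) = (p - 1) * s := by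
  have hpos := hp.out.pos
  induction s with
  | zero => simp [digitSum_zero]
  | succ s ih =>
    have h0 := pow_pos hpos s
    have h1 : p ^ (s + 1) - 1 = p ^ s * (p - 1) + (p ^ s - 1) := by
      rw [pow_succ, Nat.mul_sub, mul_one]
      have : p ^ s ≤ p ^ s * p := Nat.le_mul_of_pos_right _ hpos
      omega
    rw [h1, digitSum_pow_mul_add _ _ (by omega), ih, digitSum_of_lt (by omega)]
    ring

theorem one_le_digitSum {n : ℕ} (hn : n ≠ 0) : 1 ≤ digitSum p n := by
  by_contra h
  have h0 : digitSum p n = 0 := by omega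
  induction n using Nat.strong_induction_on with
  | _ n ih =>
    rw [digitSum_eq_mod_add_div] at h0
    by_cases h1 : n / p = 0
    · rw [Nat.div_eq_zero_iff] at h1
      have := hp.out.ne_zero
      have := Nat.mod_eq_of_lt (h1.resolve_left this)
      omega
    · exact ih _ (Nat.div_lt_self (Nat.pos_of_ne_zero hn) hp.out.one_lt) h1 (by omega) (by omega)

theorem two_le_digitSum {s n : ℕ} (h1 : p ^ s < n) (h2 : n < p ^ (s + 1)) :
    2 ≤ digitSum p n := by
  have hpos := pow_pos hp.out.pos s
  have h3 : n / p ^ s ≠ 0 := (Nat.div_pos h1.le hpos).ne'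
  have h4 := digitSum_pow_mul_add (p := p) s (n / p ^ s) (Nat.mod_lt n hpos)
  rw [Nat.div_add_mod] at h4
  by_cases h5 : n % p ^ s = 0
  · have h6 : n / p ^ s < p := Nat.div_lt_of_lt_mul (by rwa [← pow_succ])
    rw [digitSum_of_lt h6] at h4
    have h7 : n / p ^ s ≠ 1 := by
      intro h
      have := Nat.div_add_mod n (p ^ s)
      rw [h, h5] at this
      omega
    generalize n / p ^ s = d at *
    omega
  · have := one_le_digitSum (p := p) h5
    have := one_le_digitSum (p := p) h3
    omega

/-- Kummer's theorem, in digit-sum form. -/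
theorem ValGE.choose {n i : ℕ} (h : i ≤ n) :
    ValGE p (digitSum p i + digitSum p (n - i) - digitSum p n) (n.choose i : ℤ) := by
  right
  have h1 := sub_one_mul_padicValNat_choose_eq_sub_sum_digits (p := p) h
  have h2 : ((p : ℤ) - 1) * padicValInt p (n.choose i : ℤ) =
      ((p - 1) * padicValNat p (n.choose i) : ℕ) := by
    rw [padicValInt.of_nat]
    push_cast [hp.out.one_le]
    rfl
  rw [h2, h1]
  simp only [digitSum]
  omega

end digitSum

/-! ### Differences of powers and Stirling numbers. -/

/-- The `k`-th forward difference of `x ↦ x ^ n` at `0`, which is `k! * S(n, k)`. -/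
def diffPow (n k : ℕ) : ℤ := (fwdDiff 1)^[k] (fun x : ℕ => (x : ℤ) ^ n) 0

theorem fwdDiff_iter_add_pow (n k a : ℕ) :
    (fwdDiff 1)^[k] (fun x : ℕ => (x : ℤ) ^ n) a =
      ∑ i ∈ range (n + 1), (n.choose i : ℤ) * (a : ℤ) ^ i * diffPow (n - i) k := by
  have h := fwdDiff_iter_comp_add (1 : ℕ) (fun x : ℕ => (x : ℤ) ^ n) a k 0
  rw [zero_add] at h
  rw [← h]
  have h2 : (fun r : ℕ => ((r + a : ℕ) : ℤ) ^ n) = ∑ i ∈ range (n + 1),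
      ((n.choose i : ℤ) * (a : ℤ) ^ i) • (fun x : ℕ => (x : ℤ) ^ (n - i)) := by
    ext r
    push_cast
    rw [add_comm, add_pow, Finset.sum_apply]
    refine Finset.sum_congr rfl fun i _ => ?_
    simp only [Pi.smul_apply, smul_eq_mul]
    ring
  rw [h2, fwdDiff_iter_finsetSum, Finset.sum_apply]
  refine Finset.sum_congr rfl fun i _ => ?_
  rw [fwdDiff_iter_const_smul, Pi.smul_apply, smul_eq_mul, diffPow]

/-- The coefficient form of `(e^t - 1)^{a+b} = (e^t - 1)^a (e^t - 1)^b`, obtained by expanding `Δ^a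
x^n` in powers of `x`. -/
theorem diffPow_add (n a b : ℕ) :
    diffPow n (b + a) =
      ∑ i ∈ range (n + 1), (n.choose i : ℤ) * diffPow (n - i) a * diffPow i b := by
  rw [diffPow, Function.iterate_add_apply]
  have h2 : (fwdDiff 1)^[a] (fun x : ℕ => (x : ℤ) ^ n) = ∑ i ∈ range (n + 1),
      ((n.choose i : ℤ) * diffPow (n - i) a) • (fun x : ℕ => (x : ℤ) ^ i) := by
    ext x
    rw [fwdDiff_iter_add_pow, Finset.sum_apply]
    refine Finset.sum_congr rfl fun i _ => ?_
    simp only [Pi.smul_apply, smul_eq_mul]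
    ring
  rw [h2, fwdDiff_iter_finsetSum, Finset.sum_apply]
  refine Finset.sum_congr rfl fun i _ => ?_
  rw [fwdDiff_iter_const_smul, Pi.smul_apply, smul_eq_mul, diffPow, diffPow]

theorem diffPow_zero_right (n : ℕ) : diffPow n 0 = 0 ^ n := by simp [diffPow]

theorem diffPow_one_right (n : ℕ) : diffPow n 1 = 1 - 0 ^ n := by simp [diffPow, fwdDiff]

theorem diffPow_succ_right (n k : ℕ) :
    diffPow n (k + 1) = ∑ i ∈ range n, (n.choose i : ℤ) * diffPow i k := by
  rw [diffPow_add, sum_range_succ, Nat.sub_self, diffPow_one_right]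
  simp only [pow_zero, sub_self, mul_zero, zero_mul, add_zero]
  refine Finset.sum_congr rfl fun i hi => ?_
  have : n - i ≠ 0 := by have := mem_range.1 hi; omega
  rw [diffPow_one_right, zero_pow this]
  ring

/-- Leibniz rule with a factor whose second difference vanishes; at `0` it becomes the Stirling
recurrence. -/
theorem fwdDiff_iter_id_mul (f : ℕ → ℤ) (k x : ℕ) :
    (fwdDiff 1)^[k + 1] (fun x : ℕ => (x : ℤ) * f x) x =
      x * (fwdDiff 1)^[k + 1] f x +
        (k + 1) * ((fwdDiff 1)^[k] f x + (fwdDiff 1)^[k + 1] f x) := by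
  have e (j y : ℕ) : (fwdDiff 1)^[j + 1] f y = (fwdDiff 1)^[j] f (y + 1) - (fwdDiff 1)^[j] f y := by
    rw [Function.iterate_succ_apply', fwdDiff]
  induction k generalizing x with
  | zero => simp [fwdDiff]; ring
  | succ k ih =>
    rw [Function.iterate_succ_apply', fwdDiff, ih, ih]
    simp only [e]
    push_cast
    ring

theorem diffPow_eq_factorial_mul (n k : ℕ) :
    diffPow n k = k.factorial * Nat.stirlingSecond n k := by
  induction n generalizing k with
  | zero =>
    cases k with
    | zero => simp [diffPow_zero_right]
    | succ k => simp [diffPow_succ_right]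
  | succ n ih =>
    cases k with
    | zero => simp [diffPow_zero_right]
    | succ k =>
      have h : (fun x : ℕ => (x : ℤ) ^ (n + 1)) = fun x : ℕ => (x : ℤ) * (x : ℤ) ^ n := by
        ext x; ring
      rw [diffPow, h, fwdDiff_iter_id_mul]
      change _ + _ * (diffPow n k + diffPow n (k + 1)) = _
      rw [ih, ih, Nat.stirlingSecond_succ_succ, Nat.factorial_succ]
      push_cast
      ring

theorem diffPow_self (k : ℕ) : diffPow k k = k.factorial := by
  simp [diffPow_eq_factorial_mul, Nat.stirlingSecond_self]

/-- The value of `Δ^k x^n` at `p` is computed twice, by Newton's formula and by expanding `(x +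
p)^n`. The common term `diffPow n k` cancels, and the top Newton term is isolated. -/
theorem diffPow_shift (n k p : ℕ) (hp : p ≠ 0) :
    diffPow n (k + p) =
      ∑ i ∈ range n, (n.choose i : ℤ) * (p : ℤ) ^ (n - i) * diffPow i k -
        ∑ j ∈ Ioo 0 p, (p.choose j : ℤ) * diffPow n (k + j) := by
  have h1 := shift_eq_sum_fwdDiff_iter (1 : ℕ) ((fwdDiff 1)^[k] (fun x : ℕ => (x : ℤ) ^ n)) p 0
  rw [smul_eq_mul, mul_one, zero_add, fwdDiff_iter_add_pow, ← sum_range_reflect,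
    sum_range_succ, sum_range_succ, Nat.range_eq_Icc_zero_sub_one _ hp,
    ← Finset.sum_erase_add _ _ (mem_Icc.2 ⟨le_rfl, Nat.zero_le _⟩)] at h1
  have h2 : (Icc 0 (p - 1)).erase 0 = Ioo 0 p := by ext; simp; omega
  have h3 : ∀ j, p.choose j • (fwdDiff 1)^[j] ((fwdDiff 1)^[k] (fun x : ℕ => (x : ℤ) ^ n)) 0 =
      (p.choose j : ℤ) * diffPow n (k + j) := by
    intro j
    rw [← Function.iterate_add_apply, nsmul_eq_mul, diffPow, add_comm j k]
  simp only [h3] at h1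
  rw [h2] at h1
  simp only [Nat.choose_self, Nat.choose_zero_right, Nat.cast_one, one_mul, add_zero,
    add_tsub_cancel_right, Nat.sub_self, pow_zero] at h1
  have h4 : ∑ i ∈ range n, ((n.choose (n - i) : ℕ) : ℤ) * (p : ℤ) ^ (n - i) * diffPow (n - (n - i)) k
      = ∑ i ∈ range n, (n.choose i : ℤ) * (p : ℤ) ^ (n - i) * diffPow i k := by
    refine Finset.sum_congr rfl fun i hi => ?_
    have := mem_range.1 hi
    rw [Nat.choose_symm this.le, Nat.sub_sub_self this.le]
  rw [h4, Nat.sub_zero] at h1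
  linarith

/-! ### The filtration by weight and the basic bound. -/

section weights

variable {p : ℕ} [hp : Fact p.Prime]

/-- The `k`-th difference of `f` at `0` has `(p - 1) * ν_p ≥ k - m`, for all `k ≤ K`. -/
def DiffGE (p K : ℕ) (m : ℤ) (f : ℕ → ℤ) : Prop :=
  ∀ k ≤ K, ValGE p (k - m) ((fwdDiff 1)^[k] f 0)

namespace DiffGE

variable {K : ℕ} {m l : ℤ} {f g : ℕ → ℤ}

omit hp in
theorem mono (h : DiffGE p K m f) (hm : m ≤ l) : DiffGE p K l f :=
  fun k hk => (h k hk).mono (by linarith)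

theorem add (hf : DiffGE p K m f) (hg : DiffGE p K m g) : DiffGE p K m (f + g) := by
  intro k hk
  rw [fwdDiff_iter_add]
  exact (hf k hk).add (hg k hk)

theorem const_smul (hf : DiffGE p K m f) (c : ℤ) : DiffGE p K m (c • f) := by
  intro k hk
  rw [fwdDiff_iter_const_smul]
  exact (hf k hk).mul_left c

theorem sub (hf : DiffGE p K m f) (hg : DiffGE p K m g) : DiffGE p K m (f - g) := by
  have := hf.add (hg.const_smul (-1))
  rwa [neg_one_smul, ← sub_eq_add_neg] at this

theorem sum {ι : Type*} {s : Finset ι} {F : ι → ℕ → ℤ} (h : ∀ i ∈ s, DiffGE p K m (F i)) :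
    DiffGE p K m (∑ i ∈ s, F i) := by
  intro k hk
  rw [fwdDiff_iter_finsetSum, Finset.sum_apply]
  exact ValGE.sum fun i hi => h i hi k hk

omit hp in
theorem fwdDiff (hf : DiffGE p (K + 1) m f) : DiffGE p K (m - 1) (_root_.fwdDiff 1 f) := by
  intro k hk
  have := hf (k + 1) (by omega)
  rw [Function.iterate_succ_apply] at this
  exact this.mono (by push_cast; linarith)

/-- Weights add by the discrete Leibniz rule `Δ(fg) = Δf·g + f·Δg + Δf·Δg`, since each difference
lowers the weight by one. -/
theorem mul (hf : DiffGE p K m f) (hg : DiffGE p K l g) : DiffGE p K (m + l) (f * g) := by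
  induction K generalizing f g m l with
  | zero =>
    intro k hk
    obtain rfl : k = 0 := by omega
    refine ((hf 0 le_rfl).mul (hg 0 le_rfl)).mono ?_
    simp
  | succ K ih =>
    have hf' : DiffGE p K m f := fun k hk => hf k (by omega)
    have hg' : DiffGE p K l g := fun k hk => hg k (by omega)
    have key : DiffGE p K (m + l - 1) (_root_.fwdDiff 1 (f * g)) := by
      rw [← smul_eq_mul, fwdDiff_smul]
      exact (((ih hf.fwdDiff hg').mono (by linarith)).add
        ((ih hf' hg.fwdDiff).mono (by linarith))).add
        ((ih hf.fwdDiff hg.fwdDiff).mono (by linarith))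
    intro k hk
    cases k with
    | zero =>
      refine ((hf 0 (by omega)).mul (hg 0 (by omega))).mono ?_
      simp
    | succ k =>
      rw [Function.iterate_succ_apply]
      exact (key k (by omega)).mono (by push_cast; linarith)

theorem of_pow_dvd {j : ℕ} (h : ∀ x, (p : ℤ) ^ j ∣ f x) (hj : K - m ≤ ((p : ℤ) - 1) * j) :
    DiffGE p K m f := by
  intro k hk
  refine (ValGE.of_pow_dvd (j := j) ?_).mono (le_trans ?_ hj)
  · rw [fwdDiff_iter_eq_sum_shift]
    exact Finset.dvd_sum fun i _ => (h _).mul_left _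
  · have : (k : ℤ) ≤ K := by exact_mod_cast hk
    linarith

end DiffGE

theorem ValGE.diffPow_of_factorial (n k : ℕ) : ValGE p (k - digitSum p k) (diffPow n k) := by
  rw [diffPow_eq_factorial_mul]
  simpa using (ValGE.factorial k).mul (ValGE.of_nonpos (p := p) le_rfl _)

/-- In the recurrence on `k`, Kummer's term `σ(i) + σ(n-i) - σ(n)` turns `-σ(i)` into `-σ(n)`, and
`σ(n-i) ≥ 1` pays for the step. -/
theorem ValGE.diffPow (n k : ℕ) : ValGE p (k - digitSum p n) (diffPow n k) := by
  induction k generalizing n with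
  | zero =>
    exact ValGE.of_nonpos (by simp) _
  | succ k ih =>
    rw [diffPow_succ_right]
    refine ValGE.sum fun i hi => ?_
    have hi' := mem_range.1 hi
    refine ((ValGE.choose hi'.le).mul (ih i)).mono ?_
    have := one_le_digitSum (p := p) (n := n - i) (by omega)
    push_cast
    zify at this
    linarith

theorem DiffGE.pow (K n : ℕ) : DiffGE p K (digitSum p n) (fun x => (x : ℤ) ^ n) :=
  fun k _ => ValGE.diffPow n k

end weights

/-! ### Sharpness for one nonzero digit. -/

section leading

variable {p : ℕ} [hp : Fact p.Prime]

omit hp in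
theorem ValGE.dvd {q x : ℤ} (h : ValGE p q x) (hq : 0 < q) : (p : ℤ) ∣ x := by
  rcases h with rfl | h
  · exact dvd_zero _
  have h1 : padicValInt p x ≠ 0 := by
    intro h0
    rw [h0] at h
    simp at h
    omega
  exact (dvd_pow_self _ h1).trans (padicValInt_dvd x)

theorem ValGE.of_dvd {x : ℤ} (h : (p : ℤ) ∣ x) : ValGE p ((p : ℤ) - 1) x := by
  have := ValGE.of_pow_dvd (p := p) (j := 1) (x := x) (by rwa [pow_one])
  simpa using this

/-- Removing `k!` from the basic bound leaves `σ(k) - 1`, which is positive because `k` is not a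
power of `p`. -/
theorem dvd_stirlingSecond_pow {s k : ℕ} (h1 : p ^ s < k) (h2 : k < p ^ (s + 1)) :
    (p : ℤ) ∣ Nat.stirlingSecond (p ^ (s + 1)) k := by
  have h := ValGE.diffPow (p := p) (p ^ (s + 1)) k
  rw [digitSum_pow, diffPow_eq_factorial_mul,
    show ((k : ℤ) - (1 : ℕ)) = k - digitSum p k + (digitSum p k - 1) by push_cast; ring,
    ValGE.factorial_mul_iff] at h
  have := two_le_digitSum h1 h2
  exact h.dvd (by omega)

/-- Downward induction on `k` by the Stirling recurrence from row `p^(s+1)`; it starts at `k + 1 =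
p^(s+1) - p`, where the factor `k + 1` is divisible by `p`. -/
theorem dvd_stirlingSecond_pow_sub_one {s k : ℕ} (h1 : p ^ s ≤ k) (h2 : k + p < p ^ (s + 1)) :
    (p : ℤ) ∣ Nat.stirlingSecond (p ^ (s + 1) - 1) k := by
  obtain ⟨d, hd⟩ : ∃ d, k + p + 1 + d = p ^ (s + 1) := ⟨p ^ (s + 1) - (k + p + 1), by omega⟩
  have hpos := hp.out.pos
  induction d generalizing k with
  | zero =>
    have hrec := Nat.stirlingSecond_succ_succ (p ^ (s + 1) - 1) k
    rw [show p ^ (s + 1) - 1 + 1 = p ^ (s + 1) by omega] at hrec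
    have h3 := dvd_stirlingSecond_pow (p := p) (s := s) (k := k + 1) (by omega) (by omega)
    rw [hrec] at h3
    push_cast at h3
    refine (dvd_add_right (Dvd.dvd.mul_right ?_ _)).1 h3
    have h4 : p ∣ k + 1 := by
      refine (Nat.dvd_add_left (dvd_refl p)).1 ?_
      rw [show k + 1 + p = p ^ (s + 1) by omega]
      exact dvd_pow_self _ (by omega)
    exact_mod_cast h4
  | succ d ih =>
    have hrec := Nat.stirlingSecond_succ_succ (p ^ (s + 1) - 1) k
    rw [show p ^ (s + 1) - 1 + 1 = p ^ (s + 1) by omega] at hrec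
    have h3 := dvd_stirlingSecond_pow (p := p) (s := s) (k := k + 1) (by omega) (by omega)
    rw [hrec] at h3
    push_cast at h3
    exact (dvd_add_right (Dvd.dvd.mul_left (ih (by omega) (by omega) (by omega)) _)).1 h3

/-- A gain of `p - 1` over the basic bound. Divisibility by `k!` gives it unless `σ(k) > (p - 1)s`;
then the Stirling number supplies the extra `p`. -/
theorem ValGE.diffPow_pow_sub_one {s k : ℕ} (hk : k + p ≤ p ^ (s + 1)) :
    ValGE p (k - ((p : ℤ) - 1) * s) (_root_.diffPow (p ^ (s + 1) - 1) k) := by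
  have hp1 := hp.out.one_lt
  have hcast : ((p - 1 : ℕ) : ℤ) = (p : ℤ) - 1 := by push_cast [hp1.le]; rfl
  by_cases hσ : digitSum p k ≤ (p - 1) * s
  · refine (ValGE.diffPow_of_factorial _ k).mono ?_
    zify at hσ
    rw [hcast] at hσ
    linarith
  have h1 : p ^ s ≤ k := by
    by_contra h
    exact hσ (digitSum_le_of_lt_pow (by omega))
  have h2 : k + p ≠ p ^ (s + 1) := by
    intro h
    have h3 : k = (p ^ s - 1) * p ^ 1 := by
      rw [Nat.sub_mul, pow_one, one_mul, ← pow_succ]; omega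
    rw [h3, digitSum_mul_pow, digitSum_pow_sub_one] at hσ
    exact hσ le_rfl
  have h3 := ValGE.of_dvd (dvd_stirlingSecond_pow_sub_one h1 (by omega : k + p < p ^ (s + 1)))
  rw [← ValGE.factorial_mul_iff k, ← diffPow_eq_factorial_mul] at h3
  refine h3.mono ?_
  have h4 := digitSum_le_of_lt_pow (p := p) (s := s + 1) (n := k) (by omega)
  zify at h4
  rw [hcast] at h4
  linarith

/-- The contribution of `p` times derivatives to the difference `(x + p) ^ n - x ^ n`. -/
theorem ValGE.sum_choose_mul_pow_mul_diffPow {s c k : ℕ} (hc : c + 1 < p)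
    (hk : k + p ≤ p ^ (s + 1)) :
    ValGE p (k + 2 * ((p : ℤ) - 1) - c)
      (∑ i ∈ range ((c + 1) * p ^ (s + 1)), (((c + 1) * p ^ (s + 1)).choose i : ℤ) *
        (p : ℤ) ^ ((c + 1) * p ^ (s + 1) - i) * _root_.diffPow i k) := by
  have hp1 : (1 : ℤ) < p := by exact_mod_cast hp.out.one_lt
  have hpos : 0 < p ^ (s + 1) := pow_pos hp.out.pos _
  have hσ : digitSum p ((c + 1) * p ^ (s + 1)) = c + 1 := by
    rw [digitSum_mul_pow, digitSum_of_lt hc]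
  refine ValGE.sum fun i hi => ?_
  have hi' := mem_range.1 hi
  by_cases hin : i + 1 = (c + 1) * p ^ (s + 1)
  -- For `i = n - 1` a single factor `p` gives `p - 1` too little. The binomial coefficient `n`
  -- supplies `p^(s+1)`, and the sharpened bound for exponent `p^(s+1) - 1` loses only `(p - 1)s`.
  · have hsub : (c + 1) * p ^ (s + 1) - i = 1 := by omega
    rw [hsub, pow_one]
    have hi2 : i = c * p ^ (s + 1) + (p ^ (s + 1) - 1) := by
      rw [add_mul, one_mul] at hin; omega
    have hch : ((c + 1) * p ^ (s + 1)).choose i = (c + 1) * p ^ (s + 1) := by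
      rw [← hin, Nat.choose_succ_self_right]
    have h1 : ValGE p (((p : ℤ) - 1) * (s + 1)) (((c + 1) * p ^ (s + 1)).choose i : ℤ) := by
      rw [hch]
      have := ValGE.of_pow_dvd (p := p) (j := s + 1) (x := (((c + 1) * p ^ (s + 1) : ℕ) : ℤ))
        (by push_cast; exact dvd_mul_left _ _)
      push_cast at this ⊢
      exact this
    have h2 : ValGE p ((p : ℤ) - 1) (p : ℤ) := ValGE.of_dvd dvd_rfl
    have h3 : DiffGE p (p ^ (s + 1) - p) (c + ((p : ℤ) - 1) * s) (fun x => (x : ℤ) ^ i) := by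
      have h4 := DiffGE.pow (p := p) (p ^ (s + 1) - p) (c * p ^ (s + 1))
      rw [digitSum_mul_pow, digitSum_of_lt (by omega)] at h4
      have h5 : DiffGE p (p ^ (s + 1) - p) (((p : ℤ) - 1) * s)
          (fun x => (x : ℤ) ^ (p ^ (s + 1) - 1)) :=
        fun k hk' => ValGE.diffPow_pow_sub_one (by omega)
      have h6 := h4.mul h5
      have h7 : (fun x : ℕ => (x : ℤ) ^ i) =
          (fun x : ℕ => (x : ℤ) ^ (c * p ^ (s + 1))) *
            (fun x : ℕ => (x : ℤ) ^ (p ^ (s + 1) - 1)) := by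
        ext x
        rw [Pi.mul_apply, ← pow_add, ← hi2]
      rwa [h7]
    refine ((h1.mul h2).mul (h3 k (by omega))).mono ?_
    linarith
  · have h1 := ValGE.choose (p := p) hi'.le
    have h2 := ValGE.of_pow_dvd (p := p) (j := (c + 1) * p ^ (s + 1) - i)
      (dvd_refl ((p : ℤ) ^ ((c + 1) * p ^ (s + 1) - i)))
    refine ((h1.mul h2).mul (ValGE.diffPow i k)).mono ?_
    have h3 := one_le_digitSum (p := p) (n := (c + 1) * p ^ (s + 1) - i) (by omega)
    have h4 : (2 : ℤ) ≤ (((c + 1) * p ^ (s + 1) - i : ℕ) : ℤ) := by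
      exact_mod_cast (by omega : 2 ≤ (c + 1) * p ^ (s + 1) - i)
    have h5 := mul_le_mul_of_nonneg_left h4 (by linarith : (0 : ℤ) ≤ (p : ℤ) - 1)
    rw [hσ]
    push_cast
    zify at h3
    linarith

theorem pow_dvd_pow_pow_sub_pow_pow {s r : ℕ} (hsr : s ≤ r) (x : ℤ) :
    (p : ℤ) ^ (s + 1) ∣ x ^ p ^ r - x ^ p ^ s := by
  induction r, hsr using Nat.le_induction with
  | base => simp
  | succ r hsr ih =>
    have h1 : (p : ℤ) ∣ x ^ p - x := by
      rw [← ZMod.intCast_eq_intCast_iff_dvd_sub]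
      push_cast
      rw [ZMod.pow_card]
    have h2 : (p : ℤ) ^ (r + 1) ∣ (x ^ p) ^ p ^ r - x ^ p ^ r := by
      exact dvd_sub_pow_of_dvd_sub h1 r
    rw [← pow_mul, ← pow_succ'] at h2
    have := dvd_add ((pow_dvd_pow (p : ℤ) (by omega : s + 1 ≤ r + 1)).trans h2) ih
    simpa using this

theorem fwdDiff_iter_sub' (f g : ℕ → ℤ) (k x : ℕ) :
    (fwdDiff 1)^[k] (f - g) x = (fwdDiff 1)^[k] f x - (fwdDiff 1)^[k] g x := by
  have h : f - g = f + (-1 : ℤ) • g := by rw [neg_one_smul, sub_eq_add_neg]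
  rw [h, fwdDiff_iter_add, fwdDiff_iter_const_smul]
  simp [sub_eq_add_neg]

/-- Each power alone has weight `1`; their difference gains `p - 1`. Up to `k = p` this follows from
the congruence of values. Beyond, the two shift identities are subtracted: the middle differences
are handled by induction, the rest already has enough weight. -/
theorem DiffGE.pow_pow_sub_pow_pow {s r : ℕ} (hsr : s ≤ r) :
    DiffGE p (p ^ s) (2 - p)
      ((fun x : ℕ => (x : ℤ) ^ p ^ s) - (fun x : ℕ => (x : ℤ) ^ p ^ r)) := by
  have hp1 : (1 : ℤ) < p := by exact_mod_cast hp.out.one_lt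
  intro k
  induction k using Nat.strong_induction_on with
  | _ k ih =>
  intro hk
  rcases s with _ | s
  · rw [fwdDiff_iter_sub']
    change ValGE p _ (_root_.diffPow _ _ - _root_.diffPow _ _)
    have hr : p ^ r ≠ 0 := (pow_pos hp.out.pos r).ne'
    have : k = 0 ∨ k = 1 := by rw [pow_zero] at hk; omega
    rcases this with rfl | rfl
    · rw [diffPow_zero_right, diffPow_zero_right, pow_zero, zero_pow one_ne_zero, zero_pow hr]
      exact ValGE.zero p _
    · rw [diffPow_one_right, diffPow_one_right, pow_zero, zero_pow one_ne_zero, zero_pow hr]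
      exact ValGE.zero p _
  obtain ⟨r, rfl⟩ : ∃ r', r = r' + 1 := ⟨r - 1, by omega⟩
  by_cases hkp : k ≤ p
  -- Two factors `p` suffice: `p - (2 - p) = 2(p - 1)`.
  · refine DiffGE.of_pow_dvd (K := p) (j := s + 2) (fun x => ?_) ?_ k hkp
    · rw [← neg_sub]
      exact (pow_dvd_pow_pow_sub_pow_pow hsr _).neg_right
    · push_cast
      nlinarith
  · obtain ⟨k, rfl⟩ : ∃ k', k = k' + p := ⟨k - p, by omega⟩
    have hle : p ^ (s + 1) ≤ p ^ (r + 1) := Nat.pow_le_pow_right hp.out.pos hsr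
    rw [fwdDiff_iter_sub']
    change ValGE p _ (_root_.diffPow _ _ - _root_.diffPow _ _)
    rw [diffPow_shift _ _ _ hp.out.ne_zero, diffPow_shift _ _ _ hp.out.ne_zero,
      sub_sub_sub_comm, ← Finset.sum_sub_distrib]
    have e1 := ValGE.sum_choose_mul_pow_mul_diffPow (p := p) (c := 0) hp.out.one_lt hk
    have e2 := ValGE.sum_choose_mul_pow_mul_diffPow (p := p) (c := 0) hp.out.one_lt
      (hk.trans hle)
    simp only [zero_add, one_mul] at e1 e2
    refine ((e1.sub e2).mono ?_).sub (ValGE.sum fun j hj => ?_)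
    · push_cast; linarith
    · obtain ⟨hj0, hjp⟩ := mem_Ioo.1 hj
      have h1 := ih (k + j) (by omega) (by omega)
      rw [fwdDiff_iter_sub'] at h1
      have h2 : (p : ℤ) ∣ p.choose j := by
        exact_mod_cast hp.out.dvd_choose_self hj0.ne' hjp
      rw [← mul_sub]
      refine ((ValGE.of_dvd h2).mul h1).mono ?_
      push_cast
      zify at hj0
      linarith

/-- Too large a valuation at `k + p` would force one at `k + 1`, as all other terms of the shift
identity have higher weight. This descends to `k = c + 1`, where the difference is `(c + 1)!` mod
`p`, a unit. -/
theorem not_valGE_diffPow {s c d : ℕ} (hc : c + 1 < p) (hk : c + 1 + (p - 1) * d ≤ p ^ s) :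
    ¬ ValGE p (((c + 1 + (p - 1) * d : ℕ) : ℤ) - c)
      (diffPow ((c + 1) * p ^ s) (c + 1 + (p - 1) * d)) := by
  have hp2 := hp.out.two_le
  have hp1 : (1 : ℤ) < p := by exact_mod_cast hp.out.one_lt
  induction d with
  | zero =>
    intro h
    have h1 := h.dvd (by simp)
    rw [mul_zero, add_zero] at h1
    have h2 : (p : ℤ) ∣ diffPow ((c + 1) * p ^ s) (c + 1) - diffPow (c + 1) (c + 1) := by
      rw [diffPow, diffPow, ← fwdDiff_iter_sub', fwdDiff_iter_eq_sum_shift]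
      refine Finset.dvd_sum fun i _ => Dvd.dvd.mul_left ?_ _
      have := pow_dvd_pow_pow_sub_pow_pow (p := p) (Nat.zero_le s) (((0 + i • 1 : ℕ) : ℤ) ^ (c + 1))
      simp only [← pow_mul] at this
      simpa using this
    rw [dvd_sub_right h1, diffPow_self] at h2
    have h3 : p ∣ (c + 1).factorial := by exact_mod_cast h2
    rw [hp.out.dvd_factorial] at h3
    omega
  | succ d ih =>
    intro h
    have hms : (p - 1) * (d + 1) = (p - 1) * d + (p - 1) := by ring
    rcases s with _ | s
    · rw [pow_zero] at hk; omega
    refine ih (by omega) ?_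
    set k := c + (p - 1) * d with hkdef
    have hk1 : c + 1 + (p - 1) * d = k + 1 := by omega
    have hk2 : c + 1 + (p - 1) * (d + 1) = k + p := by omega
    rw [hk2] at h hk
    rw [hk1]
    have h1 := ValGE.sum_choose_mul_pow_mul_diffPow hc hk
    have hσ : digitSum p ((c + 1) * p ^ (s + 1)) = c + 1 := by
      rw [digitSum_mul_pow, digitSum_of_lt hc]
    have h2 := diffPow_shift ((c + 1) * p ^ (s + 1)) k p hp.out.ne_zero
    rw [← Finset.add_sum_erase _ _ (mem_Ioo.2 ⟨Nat.one_pos, hp.out.one_lt⟩), Nat.choose_one_right]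
      at h2
    rw [← ValGE.p_mul_iff, eq_sub_of_add_eq (eq_sub_of_add_eq' (eq_sub_iff_add_eq.1 h2)), sub_sub]
    refine (h1.mono ?_).sub (ValGE.add ?_ ?_)
    · push_cast; linarith
    · refine h.mono ?_
      push_cast
      linarith
    · refine (ValGE.sum fun j hj => ?_)
      obtain ⟨hj1, hj⟩ := mem_erase.1 hj
      obtain ⟨hj0, hjp⟩ := mem_Ioo.1 hj
      have h3 : (p : ℤ) ∣ p.choose j := by
        exact_mod_cast hp.out.dvd_choose_self hj0.ne' hjp
      refine ((ValGE.of_dvd h3).mul (ValGE.diffPow _ (k + j))).mono ?_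
      rw [hσ]
      have : (2 : ℤ) ≤ j := by exact_mod_cast (by omega : 2 ≤ j)
      push_cast
      linarith

end leading

/-! ### Periodicity mod `p - 1` and the uniform bound. -/

section periodicity

variable {p : ℕ} [hp : Fact p.Prime]

theorem DiffGE.of_pow_pow_dvd {s : ℕ} {f : ℕ → ℤ} (h : ∀ x, (p : ℤ) ^ p ^ s ∣ f x) :
    DiffGE p (p ^ s) (2 - p) f := by
  refine DiffGE.of_pow_dvd h ?_
  have h1 : (1 : ℤ) ≤ (p ^ s : ℕ) := by exact_mod_cast Nat.one_le_pow _ _ hp.out.pos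
  have h2 : (2 : ℤ) ≤ p := by exact_mod_cast hp.out.two_le
  nlinarith

theorem pow_pow_mul_pow_sub_one (x : ℤ) (r : ℕ) :
    x ^ p ^ r * ((x ^ p ^ r) ^ (p - 1) - 1) = x ^ p ^ r.succ - x ^ p ^ r := by
  rw [mul_sub, mul_one, ← pow_succ', Nat.sub_add_cancel hp.out.one_le, ← pow_mul, ← pow_succ]

theorem DiffGE.pow_succ_of_nonpos {K : ℕ} {m : ℤ} {f : ℕ → ℤ} (hf : DiffGE p K m f) (hm : m ≤ 0)
    (i : ℕ) : DiffGE p K m (f ^ (i + 1)) := by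
  induction i with
  | zero => rwa [zero_add, pow_one]
  | succ i ih =>
    rw [pow_succ]
    exact (ih.mul hf).mono (by linarith)

/-- If `p ∤ x`, then `x^(p^(p^s))` approximates a Teichmüller representative and the second factor
is divisible. If `p ∣ x`, both powers in the first factor are. -/
theorem pow_pow_dvd_mul_sub_one {s : ℕ} (x : ℤ) :
    (p : ℤ) ^ p ^ s ∣ (x ^ p ^ s - x ^ p ^ p ^ s) * ((x ^ p ^ p ^ s) ^ (p - 1) - 1) := by
  have h1 : (p : ℤ) ^ p ^ s ∣ x ^ p ^ p ^ s * ((x ^ p ^ p ^ s) ^ (p - 1) - 1) := by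
    have h := pow_dvd_pow_pow_sub_pow_pow (p := p) (Nat.le_succ (p ^ s)) x
    rw [pow_pow_mul_pow_sub_one]
    exact (pow_dvd_pow _ (Nat.le_succ _)).trans h
  rw [sub_mul]
  refine dvd_sub ?_ h1
  by_cases hx : (p : ℤ) ∣ x
  · exact (pow_dvd_pow_of_dvd hx _).mul_right _
  · refine Dvd.dvd.mul_left (IsCoprime.dvd_of_dvd_mul_left ?_ h1) _
    exact IsCoprime.pow ((Nat.prime_iff_prime_int.1 hp.out).coprime_iff_not_dvd.2 hx)

/-- The function `x ↦ x ^ p ^ s`. -/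
def powPow (p s : ℕ) : ℕ → ℤ := fun x => (x : ℤ) ^ p ^ s

theorem powPow_pow (p s m : ℕ) : powPow p s ^ m = fun x : ℕ => (x : ℤ) ^ (m * p ^ s) := by
  ext x
  rw [Pi.pow_apply, powPow, ← pow_mul, mul_comm]

/-- For `m ≤ p - 2` the weights `2 - p` and `m` add up to at most `0`. Larger `m` drops by `p - 1`
at a time, at the cost of a function divisible by `p^(p^s)`. -/
theorem DiffGE.powPow_sub_pow_mul {s : ℕ} {i : ℕ} (m : ℕ) :
    DiffGE p (p ^ s) 0
      ((powPow p s - powPow p (p ^ s)) ^ (i + 1) * powPow p (p ^ s) ^ m) := by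
  have hp2 : (2 : ℤ) ≤ p := by exact_mod_cast hp.out.two_le
  induction m using Nat.strong_induction_on with
  | _ m ih =>
  by_cases hm : m + 1 < p
  · have h1 : DiffGE p (p ^ s) (2 - p) ((powPow p s - powPow p (p ^ s)) ^ (i + 1)) :=
      (DiffGE.pow_pow_sub_pow_pow (Nat.lt_pow_self hp.out.one_lt).le).pow_succ_of_nonpos
        (by linarith) i
    have h2 : DiffGE p (p ^ s) m (powPow p (p ^ s) ^ m) := by
      have h3 := DiffGE.pow (p := p) (p ^ s) (m * p ^ p ^ s)
      rw [digitSum_mul_pow, digitSum_of_lt (by omega)] at h3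
      rwa [powPow_pow]
    refine (h1.mul h2).mono ?_
    zify at hm
    linarith
  · obtain ⟨m, rfl⟩ : ∃ m', m = m' + (p - 1) := ⟨m - (p - 1), by omega⟩
    have hpos := hp.out.one_lt
    have h1 := ih m (by omega)
    have h2 : DiffGE p (p ^ s) (2 - p) ((powPow p s - powPow p (p ^ s)) ^ (i + 1) *
        powPow p (p ^ s) ^ m * (powPow p (p ^ s) ^ (p - 1) - 1)) := by
      refine DiffGE.of_pow_pow_dvd fun x => ?_
      have h3 := (pow_pow_dvd_mul_sub_one (p := p) (s := s) x).mul_left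
        ((powPow p s x - powPow p (p ^ s) x) ^ i * powPow p (p ^ s) x ^ m)
      refine h3.trans (dvd_of_eq ?_)
      simp only [Pi.mul_apply, Pi.pow_apply, Pi.sub_apply, Pi.one_apply, powPow]
      ring
    have h4 := h1.add (h2.mono (l := 0) (by linarith))
    convert h4 using 1
    ring

theorem DiffGE.powPow_pow_sub_powPow_pow (s c : ℕ) :
    DiffGE p (p ^ s) 0 (powPow p s ^ c - powPow p (p ^ s) ^ c) := by
  have h : powPow p s ^ c - powPow p (p ^ s) ^ c = ∑ i ∈ range c, ((c.choose (i + 1) : ℕ) : ℤ) •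
      ((powPow p s - powPow p (p ^ s)) ^ (i + 1) * powPow p (p ^ s) ^ (c - (i + 1))) := by
    conv_lhs => rw [← sub_add_cancel (powPow p s) (powPow p (p ^ s)), add_pow, sum_range_succ']
    simp only [pow_zero, Nat.choose_zero_right, Nat.cast_one, mul_one, one_mul, Nat.sub_zero,
      add_sub_cancel_right]
    refine Finset.sum_congr rfl fun i _ => ?_
    rw [zsmul_eq_mul, mul_comm]
    simp
  rw [h]
  exact DiffGE.sum fun i _ => (DiffGE.powPow_sub_pow_mul _).const_smul _

/-- Replace `x^(p^s)` by `T = x^(p^(p^s))`; modulo `p^(p^s)`, positive powers of `T` depend only on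
the exponent mod `p - 1`. -/
theorem DiffGE.powPow_pow_add_sub (s c d : ℕ) :
    DiffGE p (p ^ s) 0 (powPow p s ^ (c + 1 + (p - 1) * d) - powPow p s ^ (c + 1)) := by
  have hp2 : (2 : ℤ) ≤ p := by exact_mod_cast hp.out.two_le
  have h1 : DiffGE p (p ^ s) 0
      (powPow p (p ^ s) ^ (c + 1 + (p - 1) * d) - powPow p (p ^ s) ^ (c + 1)) := by
    refine (DiffGE.of_pow_pow_dvd fun x => ?_).mono (by linarith)
    have h := pow_dvd_pow_pow_sub_pow_pow (p := p) (Nat.le_succ (p ^ s)) x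
    have h3 := sub_dvd_pow_sub_pow (((x : ℤ) ^ p ^ p ^ s) ^ (p - 1)) 1 d
    rw [one_pow] at h3
    have h4 := mul_dvd_mul_left ((x : ℤ) ^ p ^ p ^ s) h3
    rw [pow_pow_mul_pow_sub_one] at h4
    have h5 := (((pow_dvd_pow _ (Nat.le_succ _)).trans h).trans h4).mul_left
      (((x : ℤ) ^ p ^ p ^ s) ^ c)
    refine h5.trans (dvd_of_eq ?_)
    simp only [Pi.pow_apply, Pi.sub_apply, powPow]
    ring
  have h2 := ((DiffGE.powPow_pow_sub_powPow_pow (p := p) s (c + 1 + (p - 1) * d)).add h1).sub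
    (DiffGE.powPow_pow_sub_powPow_pow s (c + 1))
  convert h2 using 1
  abel

theorem ValGE.diffPow_add_sub_mul_pow (s c d : ℕ) {k : ℕ} (hk : k ≤ p ^ s) :
    ValGE p k (_root_.diffPow ((c + 1 + (p - 1) * d) * p ^ s) k -
      _root_.diffPow ((c + 1) * p ^ s) k) := by
  have h := DiffGE.powPow_pow_add_sub (p := p) s c d k hk
  rwa [sub_zero, fwdDiff_iter_sub', powPow_pow, powPow_pow] at h

theorem ValGE.diffPow_mul_pow {s c k : ℕ} (hc : c + 1 < p) (hk : k ≤ p ^ s) (d : ℕ) :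
    ValGE p (k - (c + 1)) (_root_.diffPow ((c + 1 + (p - 1) * d) * p ^ s) k) := by
  have h1 := (ValGE.diffPow_add_sub_mul_pow (p := p) s c d hk).mono
    (q₂ := k - (c + 1)) (by linarith)
  have h2 := ValGE.diffPow (p := p) ((c + 1) * p ^ s) k
  rw [digitSum_mul_pow, digitSum_of_lt hc] at h2
  simpa using h1.add h2

theorem ValGE.diffPow_mul_pow' {s c k : ℕ} (hc : c ≠ 0) (hk : k ≤ p ^ s) :
    ValGE p (k - ((p : ℤ) - 1)) (_root_.diffPow (c * p ^ s) k) := by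
  have hp2 := hp.out.two_le
  have h1 := Nat.mod_lt (c - 1) (by omega : 0 < p - 1)
  have h2 := Nat.mod_add_div (c - 1) (p - 1)
  have h := ValGE.diffPow_mul_pow (p := p) (c := (c - 1) % (p - 1)) (by omega) hk
    ((c - 1) / (p - 1))
  rw [show (c - 1) % (p - 1) + 1 + (p - 1) * ((c - 1) / (p - 1)) = c by omega] at h
  refine h.mono ?_
  have h3 : (((c - 1) % (p - 1) : ℕ) : ℤ) + 1 ≤ (p : ℤ) - 1 := by omega
  linarith

theorem not_valGE_diffPow_mul_pow {s c d e : ℕ} (hc : c + 1 < p)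
    (hk : c + 1 + (p - 1) * d ≤ p ^ s) :
    ¬ ValGE p (((c + 1 + (p - 1) * d : ℕ) : ℤ) - c)
      (diffPow ((c + 1 + (p - 1) * e) * p ^ s) (c + 1 + (p - 1) * d)) := by
  intro h
  refine not_valGE_diffPow hc hk ?_
  have h1 := (ValGE.diffPow_add_sub_mul_pow (p := p) s c e hk).mono
    (q₂ := ((c + 1 + (p - 1) * d : ℕ) : ℤ) - c) (by linarith)
  simpa using h.sub h1

/-- From `i * C(n,i) = n * C(n-1,i-1)`. -/
theorem pow_sub_dvd_choose {h s n i : ℕ} (hn : p ^ h ∣ n) (hi : i ≠ 0) (hin : i ≤ n)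
    (hs : padicValNat p i = s) : p ^ (h - s) ∣ n.choose i := by
  obtain ⟨i', hi'⟩ : p ^ s ∣ i := hs ▸ pow_padicValNat_dvd
  have h1 : ¬ p ∣ i' := by
    rintro ⟨j, rfl⟩
    refine pow_succ_padicValNat_not_dvd (p := p) hi ⟨j, ?_⟩
    rw [hs]
    conv_lhs => rw [hi']
    ring
  rcases le_or_gt h s with hle | hlt
  · simp [Nat.sub_eq_zero_of_le hle]
  have h2 : n.choose i * i = n * (n - 1).choose (i - 1) := by
    have := Nat.add_one_mul_choose_eq (n - 1) (i - 1)
    rw [Nat.sub_add_cancel (by omega), Nat.sub_add_cancel (by omega)] at this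
    exact this.symm
  have h3 : p ^ s * p ^ (h - s) ∣ p ^ s * (n.choose i * i') := by
    rw [← pow_add, Nat.add_sub_cancel' hlt.le, mul_left_comm, ← hi', h2]
    exact hn.mul_right _
  have h4 := Nat.dvd_of_mul_dvd_mul_left (pow_pos hp.out.pos s) h3
  exact (((Nat.Prime.coprime_iff_not_dvd hp.out).2 h1).pow_left _).dvd_of_dvd_mul_right h4

/-- If `p^h ∤ n - i`, put `s = ν_p(i) < h` and split `k` at the digit `p^s` by convolution.
Induction at level `s` treats the low part, the binomial coefficient in the statement being what the
convolution produces. Legendre's bound on the high part loses `σ(k / p^s) ≤ (p - 1)(h - s)`, which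
`p^(h-s) ∣ C(n,i)` repays. -/
theorem ValGE.choose_mul_diffPow {h n k i : ℕ} (hn : p ^ h ∣ n) (hk : k ≤ p ^ h) (hi : i ≤ n) :
    ValGE p (k - ((p : ℤ) - 1)) ((n.choose i : ℤ) * _root_.diffPow (n - i) k) := by
  have hp2 : (2 : ℤ) ≤ p := by exact_mod_cast hp.out.two_le
  induction h using Nat.strong_induction_on generalizing n k i with
  | _ h ih =>
  rcases Nat.eq_zero_or_pos k with rfl | hk0
  · exact ValGE.of_nonpos (by push_cast; linarith) _
  by_cases hni : n - i = 0
  · obtain ⟨k, rfl⟩ : ∃ k', k = k' + 1 := ⟨k - 1, by omega⟩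
    rw [hni, diffPow_succ_right, range_zero, sum_empty, mul_zero]
    exact ValGE.zero p _
  by_cases hdvd : p ^ h ∣ n - i
  · obtain ⟨c, hc⟩ := hdvd
    rw [hc, mul_comm (p ^ h)]
    exact (ValGE.diffPow_mul_pow' (by rintro rfl; simp [hni] at hc) hk).mul_left _
  have hi0 : i ≠ 0 := by rintro rfl; exact hdvd (by simpa using hn)
  set s := padicValNat p i with hs
  have hsh : s < h := by
    by_contra hle
    exact hdvd (Nat.dvd_sub hn ((pow_dvd_pow p (not_lt.1 hle)).trans pow_padicValNat_dvd))
  have hpow := pow_pos hp.out.pos s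
  have h1 := ValGE.of_pow_dvd (p := p) (j := h - s) (x := n.choose i)
    (by exact_mod_cast pow_sub_dvd_choose hn hi0 hi hs.symm)
  have h2 : p ^ s ∣ n - i :=
    Nat.dvd_sub ((pow_dvd_pow p hsh.le).trans hn) pow_padicValNat_dvd
  have h3 : digitSum p (k / p ^ s) ≤ (p - 1) * (h - s) := by
    have h4 : k / p ^ s ≤ p ^ (h - s) := by
      rw [Nat.div_le_iff_le_mul_add_pred hpow, ← pow_add, Nat.add_sub_cancel' hsh.le]
      omega
    -- Equality occurs when `k = p^h`; the digit sum is then `1`.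
    rcases h4.lt_or_eq with h5 | h5
    · exact digitSum_le_of_lt_pow h5
    · rw [h5, digitSum_pow]
      exact Nat.mul_pos (by omega) (by omega)
  have h6 : ValGE p (k - ((p : ℤ) - 1) - digitSum p (k / p ^ s)) (_root_.diffPow (n - i) k) := by
    have hk' := Nat.div_add_mod' k (p ^ s)
    conv => enter [3]; rw [← hk']
    rw [diffPow_add]
    refine ValGE.sum fun j hj => ?_
    have hj' : j ≤ n - i := by have := mem_range.1 hj; omega
    have h7 := ih s hsh (k := k % p ^ s) h2 (Nat.mod_lt _ hpow).le hj'
    have h8 := ValGE.diffPow_of_factorial (p := p) j (k / p ^ s * p ^ s)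
    rw [digitSum_mul_pow] at h8
    refine (h7.mul h8).mono ?_
    zify at hk'
    push_cast
    linarith
  refine (h1.mul h6).mono ?_
  zify at h3
  rw [Nat.cast_sub hp.out.one_le] at h3
  push_cast at h3 ⊢
  linarith

end periodicity

/-! ### Coefficients of the Bernoulli polynomials. -/

theorem coeff_exp_sub_one_pow (n k : ℕ) :
    PowerSeries.coeff n ((PowerSeries.exp ℚ - 1) ^ k) = (diffPow n k : ℚ) / n.factorial := by
  induction k generalizing n with
  | zero =>
    rw [pow_zero, PowerSeries.coeff_one, diffPow_zero_right]
    rcases n with _ | n <;> simp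
  | succ k ih =>
    rw [pow_succ, PowerSeries.coeff_mul, Nat.sum_antidiagonal_eq_sum_range_succ
      (fun i j => PowerSeries.coeff i ((PowerSeries.exp ℚ - 1) ^ k) *
        PowerSeries.coeff j (PowerSeries.exp ℚ - 1)), sum_range_succ, diffPow_succ_right]
    simp only [Nat.sub_self, map_sub, PowerSeries.coeff_exp, PowerSeries.coeff_one]
    simp only [Nat.factorial_zero, if_true, Nat.cast_one, div_one, map_one, sub_self, mul_zero,
      add_zero]
    push_cast
    rw [Finset.sum_div]
    refine Finset.sum_congr rfl fun i hi => ?_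
    have hi' := mem_range.1 hi
    rw [ih, if_neg (by omega), sub_zero, Nat.cast_choose ℚ hi'.le]
    have h1 : (n.factorial : ℚ) ≠ 0 := by exact_mod_cast n.factorial_ne_zero
    field_simp

theorem coeff_expSubOneDivT_pow (j k : ℕ) :
    PowerSeries.coeff j (expSubOneDivT ^ k) = (diffPow (j + k) k : ℚ) / (j + k).factorial := by
  rw [← coeff_exp_sub_one_pow, ← X_mul_expSubOneDivT, mul_pow, PowerSeries.coeff_X_pow_mul]

theorem bernoulliFactor_neg (k : ℕ) : bernoulliFactor (-(k : ℤ)) = expSubOneDivT ^ k := by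
  cases k with
  | zero => exact pow_zero _
  | succ k => rfl

theorem coeff_higherBernoulli (l : ℤ) (m i : ℕ) :
    (higherBernoulli l m).coeff i = if i ≤ m then
      (m.factorial : ℚ) * (PowerSeries.coeff (m - i) (bernoulliFactor l) / i.factorial)
      else 0 := by
  rw [higherBernoulli, Polynomial.coeff_smul, PowerSeries.coeff_mul,
    Nat.sum_antidiagonal_eq_sum_range_succ_mk, Polynomial.finsetSum_coeff]
  have h (j : ℕ) : (PowerSeries.coeff j
      (PowerSeries.map (Polynomial.C : ℚ →+* Polynomial ℚ) (bernoulliFactor l)) *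
      PowerSeries.coeff (m - j)
        (PowerSeries.rescale (Polynomial.X : Polynomial ℚ) (PowerSeries.exp (Polynomial ℚ)))).coeff i
      = if i = m - j then PowerSeries.coeff j (bernoulliFactor l) / (m - j).factorial else 0 := by
    rw [PowerSeries.coeff_map, PowerSeries.coeff_rescale, PowerSeries.coeff_exp,
      Polynomial.algebraMap_apply, Polynomial.coeff_C_mul, Polynomial.coeff_mul_C,
      Polynomial.coeff_X_pow]
    split_ifs <;> simp [div_eq_mul_inv]
  simp only [h]
  split_ifs with him
  · rw [Finset.sum_eq_single (m - i)]
    · rw [Nat.sub_sub_self him, if_pos rfl, smul_eq_mul]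
    · intro j hj hji
      have := mem_range.1 hj
      rw [if_neg (by omega)]
    · intro hm
      exact absurd (mem_range.2 (by omega)) hm
  · rw [Finset.sum_eq_zero, smul_zero]
    intro j hj
    rw [if_neg (by omega)]

theorem coeff_higherBernoulli_mul_choose {n k i : ℕ} (h : i + k ≤ n) :
    (higherBernoulli (-(k : ℤ)) (n - k)).coeff i * n.choose k =
      n.choose i * Nat.stirlingSecond (n - i) k := by
  rw [coeff_higherBernoulli, if_pos (by omega), bernoulliFactor_neg, coeff_expSubOneDivT_pow,
    show n - k - i + k = n - i by omega, diffPow_eq_factorial_mul,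
    Nat.cast_choose ℚ (by omega : k ≤ n), Nat.cast_choose ℚ (by omega : i ≤ n)]
  have h1 (j : ℕ) : (j.factorial : ℚ) ≠ 0 := by exact_mod_cast j.factorial_ne_zero
  have := h1 n
  have := h1 k
  have := h1 i
  have := h1 (n - k)
  have := h1 (n - i)
  push_cast
  field_simp

/-! ### Maximum pole and exact valuation. -/

section poles

variable {p : ℕ} [hp : Fact p.Prime]

theorem padicValNat_den (r : ℚ) : (padicValNat p r.den : ℤ) = max 0 (-padicValRat p r) := by
  rw [padicValRat_def]
  by_cases h : p ∣ r.den
  · have h1 : ¬ (p : ℤ) ∣ r.num := by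
      intro h2
      have := Nat.dvd_gcd (Int.natCast_dvd.1 h2) h
      rw [r.reduced] at this
      exact hp.out.one_lt.ne' (Nat.dvd_one.1 this)
    rw [padicValInt.eq_zero_of_not_dvd h1]
    simp
  · rw [padicValNat.eq_zero_of_not_dvd h]
    simp

/-- Under `hle` no coefficient has smaller valuation than the constant one, `S(n,k) / C(n,k)`. -/
theorem maxPole_higherBernoulli {n k : ℕ} (hkn : k ≤ n) (hS : Nat.stirlingSecond n k ≠ 0)
    (hle : ∀ i, i + k ≤ n → Nat.stirlingSecond (n - i) k ≠ 0 →
      padicValNat p (Nat.stirlingSecond n k) ≤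
        padicValNat p (n.choose i * Nat.stirlingSecond (n - i) k)) :
    (maxPole p (higherBernoulli (-(k : ℤ)) (n - k)) : ℤ) =
      padicValNat p (n.choose k) - padicValNat p (Nat.stirlingSecond n k) := by
  have hC : n.choose k ≠ 0 := (Nat.choose_pos hkn).ne'
  have hval (i : ℕ) (hi : i + k ≤ n) (hSi : Nat.stirlingSecond (n - i) k ≠ 0) :
      padicValRat p ((higherBernoulli (-(k : ℤ)) (n - k)).coeff i) =
        padicValNat p (n.choose i * Nat.stirlingSecond (n - i) k) - padicValNat p (n.choose k) := by
    have hC' : (n.choose k : ℚ) ≠ 0 := by exact_mod_cast hC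
    have hA : ((n.choose i * Nat.stirlingSecond (n - i) k : ℕ) : ℚ) ≠ 0 := by
      exact_mod_cast mul_ne_zero (Nat.choose_pos (by omega)).ne' hSi
    rw [eq_div_of_mul_eq hC' (coeff_higherBernoulli_mul_choose hi), ← Nat.cast_mul,
      padicValRat.div hA hC', padicValRat.of_nat, padicValRat.of_nat]
  have h0 := hval 0 (by omega) (by simpa using hS)
  rw [Nat.choose_zero_right, one_mul, Nat.sub_zero] at h0
  -- The leading coefficient is `1`, so the constant one has valuation at most `0` and the natural
  -- subtraction does not truncate.
  have hnonneg : padicValNat p (Nat.stirlingSecond n k) ≤ padicValNat p (n.choose k) := by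
    have := hle (n - k) (by omega) (by simp [Nat.sub_sub_self hkn, Nat.stirlingSecond_self])
    rwa [Nat.sub_sub_self hkn, Nat.stirlingSecond_self, mul_one, Nat.choose_symm hkn] at this
  rw [← Nat.cast_sub hnonneg, Nat.cast_inj]
  refine le_antisymm (Finset.sup_le fun i hi => ?_) ?_
  · rw [Polynomial.mem_support_iff] at hi
    have him : i + k ≤ n := by
      by_contra h
      rw [coeff_higherBernoulli, if_neg (by omega)] at hi
      exact hi rfl
    have hSi : Nat.stirlingSecond (n - i) k ≠ 0 := by
      intro h
      have := coeff_higherBernoulli_mul_choose him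
      rw [h, Nat.cast_zero, mul_zero] at this
      exact (mul_ne_zero hi (by exact_mod_cast hC)) this
    have h1 := hle i him hSi
    have h2 := padicValNat_den (p := p) ((higherBernoulli (-(k : ℤ)) (n - k)).coeff i)
    rw [hval i him hSi] at h2
    omega
  · have h2 := padicValNat_den (p := p) ((higherBernoulli (-(k : ℤ)) (n - k)).coeff 0)
    rw [h0] at h2
    have h3 : padicValNat p ((higherBernoulli (-(k : ℤ)) (n - k)).coeff 0).den =
        padicValNat p (n.choose k) - padicValNat p (Nat.stirlingSecond n k) := by omega
    rw [← h3]
    refine Finset.le_sup (f := fun i =>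
      padicValNat p ((higherBernoulli (-(k : ℤ)) (n - k)).coeff i).den) ?_
    rw [Polynomial.mem_support_iff]
    intro h
    have := coeff_higherBernoulli_mul_choose (n := n) (k := k) (i := 0) (by omega)
    rw [h, zero_mul, Nat.choose_zero_right, Nat.sub_zero, Nat.cast_one, one_mul] at this
    exact hS (by exact_mod_cast this.symm)

theorem sub_one_mul_padicValNat_stirlingSecond {h c d e : ℕ} (hc : c + 1 < p)
    (hk : c + 1 + (p - 1) * d ≤ p ^ h) :
    Nat.stirlingSecond ((c + 1 + (p - 1) * e) * p ^ h) (c + 1 + (p - 1) * d) ≠ 0 ∧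
    ((p : ℤ) - 1) * padicValNat p
      (Nat.stirlingSecond ((c + 1 + (p - 1) * e) * p ^ h) (c + 1 + (p - 1) * d)) =
      digitSum p (c + 1 + (p - 1) * d) - (c + 1) := by
  have h1 := ValGE.diffPow_mul_pow hc hk e
  have h2 := not_valGE_diffPow_mul_pow (e := e) hc hk
  generalize c + 1 + (p - 1) * d = k at *
  rw [diffPow_eq_factorial_mul] at h1 h2
  rw [show (k : ℤ) - (c + 1) = k - digitSum p k + (digitSum p k - (c + 1)) by ring,
    ValGE.factorial_mul_iff] at h1
  rw [show (k : ℤ) - c = k - digitSum p k + (digitSum p k - c) by ring,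
    ValGE.factorial_mul_iff] at h2
  simp only [ValGE, not_or, padicValInt.of_nat] at h1 h2
  have h3 := h1.resolve_left h2.1
  exact ⟨by exact_mod_cast h2.1, by omega⟩

end poles

/-! ### The main theorem. -/

theorem mainTheorem3 (p : ℕ) (hp : p.Prime) (n k h : ℕ) (hn : 0 < n)
    (hdvd : p ^ h ∣ n) (hk : 0 < k) (hkp : k ≤ p ^ h)
    (hmod : (p : ℤ) - 1 ∣ (n : ℤ) - (k : ℤ)) :
    IsAMZC p n k ∧
      (padicValNat p (Nat.stirlingSecond n k) : ℚ) =
        ((digitSum p k : ℚ) - (leastPosResidue (p - 1) k : ℚ)) / ((p : ℚ) - 1) ∧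
      (padicValNat p (Nat.stirlingSecond n k) : ℤ) =
        ⌊((digitSum p k : ℚ) - 1) / ((p : ℚ) - 1)⌋ := by
  have : Fact p.Prime := ⟨hp⟩
  have hp2 := hp.two_le
  have hp1 : (0 : ℚ) < (p : ℚ) - 1 := by
    have : (2 : ℚ) ≤ p := by exact_mod_cast hp2
    linarith
  obtain ⟨t, rfl⟩ := hdvd
  have ht : t ≠ 0 := by rintro rfl; simp at hn
  have hcast : ((p - 1 : ℕ) : ℤ) = (p : ℤ) - 1 := Nat.cast_pred hp.pos
  -- Since `p^h ≡ 1` mod `p - 1`, the multiplier `t` has the residue of `k`. Subtracting `1` first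
  -- makes `c + 1` the least positive residue.
  have htk : k - 1 ≡ t - 1 [MOD p - 1] := by
    rw [Nat.modEq_iff_dvd, hcast]
    have h1 : (p : ℤ) - 1 ∣ (p : ℤ) ^ h - 1 := by simpa using sub_dvd_pow_sub_pow (p : ℤ) 1 h
    have h2 := dvd_sub hmod (h1.mul_left t)
    rw [Nat.cast_pred hk, Nat.cast_pred (Nat.pos_of_ne_zero ht)]
    push_cast at h2
    obtain ⟨w, hw⟩ := h2
    exact ⟨w, by linear_combination hw⟩
  obtain ⟨c, d, e, hc, hkc, htc⟩ : ∃ c d e, c + 1 < p ∧ c + 1 + (p - 1) * d = k ∧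
      c + 1 + (p - 1) * e = t := by
    refine ⟨(k - 1) % (p - 1), (k - 1) / (p - 1), (t - 1) / (p - 1), ?_, ?_, ?_⟩
    · have := Nat.mod_lt (k - 1) (by omega : 0 < p - 1)
      omega
    · have := Nat.mod_add_div (k - 1) (p - 1)
      omega
    · have := Nat.mod_add_div (t - 1) (p - 1)
      rw [htk]
      omega
  have hr : leastPosResidue (p - 1) k = c + 1 := by
    obtain ⟨h1, h2, h3⟩ := leastPosResidue_spec (by omega : 0 < p - 1) k
    have h4 : leastPosResidue (p - 1) k ≡ c + 1 [MOD p - 1] := by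
      refine h3.trans ?_
      rw [← hkc]
      simp [Nat.ModEq]
    refine Nat.ModEq.eq_of_abs_lt h4 ?_
    rw [abs_lt]
    constructor <;> push_cast <;> omega
  obtain ⟨hS, hv⟩ := sub_one_mul_padicValNat_stirlingSecond (p := p) (h := h) (d := d) (e := e) hc
    (by rwa [hkc])
  rw [hkc, htc, mul_comm t] at hS hv
  have hkn : k ≤ p ^ h * t := hkp.trans (Nat.le_mul_of_pos_right _ (Nat.pos_of_ne_zero ht))
  have hvQ : ((p : ℚ) - 1) * padicValNat p (Nat.stirlingSecond (p ^ h * t) k) =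
      digitSum p k - (c + 1) := by
    have := congrArg (Int.cast : ℤ → ℚ) hv
    simpa only [Int.cast_mul, Int.cast_sub, Int.cast_add, Int.cast_one, Int.cast_natCast] using this
  refine ⟨⟨hS, ?_⟩, ?_, ?_⟩
  · rw [maxPole_higherBernoulli hkn hS]
    · ring
    intro i hi hSi
    have h1 := ValGE.choose_mul_diffPow (p := p) (n := p ^ h * t) (dvd_mul_right _ _) hkp
      (by omega : i ≤ _)
    rw [diffPow_eq_factorial_mul, mul_left_comm,
      show (k : ℤ) - (p - 1) = k - digitSum p k + (digitSum p k - (p - 1)) by ring,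
      ValGE.factorial_mul_iff, ← Nat.cast_mul] at h1
    have h2 := h1.resolve_left
      (by exact_mod_cast mul_ne_zero (Nat.choose_pos (by omega)).ne' hSi)
    rw [padicValInt.of_nat] at h2
    -- A defect of one unit would cost `p - 1`, giving `σ(k) ≤ σ(k) - (c + 1)`.
    by_contra! h3
    have h4 : (padicValNat p ((p ^ h * t).choose i * Nat.stirlingSecond (p ^ h * t - i) k) : ℤ) + 1 ≤
      padicValNat p (Nat.stirlingSecond (p ^ h * t) k) := by exact_mod_cast h3
    have h5 := mul_le_mul_of_nonneg_left h4 (by omega : (0 : ℤ) ≤ (p : ℤ) - 1)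
    rw [hv, mul_add] at h5
    linarith
  · rw [hr, eq_div_iff hp1.ne']
    push_cast
    linarith
  · rw [eq_comm, Int.floor_eq_iff]
    have hc' : (c : ℚ) + 1 < p := by exact_mod_cast hc
    have hc0 : (0 : ℚ) ≤ c := by positivity
    constructor
    · rw [le_div_iff₀ hp1, Int.cast_natCast]
      linarith
    · rw [div_lt_iff₀ hp1, Int.cast_natCast]
      linarith
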